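/- Let $V=\bigoplus_{n=0}^{\infty}V_n$ be a vertex operator algebra over $\mathbb{C}$ (with $\dim V_n<\infty$ for all $n$), with vacuum $\mathbf 1$, and write $Y(a,z)=\sum_{n\in\mathbb{Z}}a_n z^{-n-1}$ for $a\in V$. Suppose that $V$ is strongly generated by finitely many homogeneous elements $x^1,\dots,x^n$, that is, $V$ is spanned by the vectors $$a^{1}_{-n_1}\cdots a^{r}_{-n_r}\mathbf 1,\qquad r\ge 0,\ a^{i}\in\{x^1,\dots,x^n\},\ n_i\ge 1 .$$ Then Zhu's algebra $A(V)$ is left noetherian. Here $A(V)=V/O(V)$, where $O(V)$ is the linear span of the elements $\operatorname{Res}_z Y(a,z)b\,\frac{(1+z)^{m}}{z^{2}}$ for $m\ge 0$, $a\in V_m$ and $b\in V$; its product is induced by the bilinear operation on $V$ given by $$a\ast b=\operatorname{Res}_z Y(a,z)b\,\frac{(1+z)^{m}}{z}=\sum_{j=0}^{m}\binom{m}{j}a_{j-1}b\qquad(a\in V_m,\ b\in V),$$ and its identity is $\mathbf 1+O(V)$. -/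

import Mathlib

/-- For a linear map `Y` from `V` to fields on `V`, `modeOf Y n a b` is `a_n b`, where
`Y(a,z) b = ∑ a_n b z^{-n-1}`. -/
noncomputable def modeOf {V : Type*} [AddCommGroup V] [Module ℂ V]
    (Y : V →ₗ[ℂ] VertexOperator ℂ V) (n : ℤ) : V →ₗ[ℂ] V →ₗ[ℂ] V :=
  LinearMap.proj n ∘ₗ VertexOperator.ncoeff ∘ₗ Y

/-- A vertex operator algebra over `ℂ`, graded by nonnegative weights.
Since `Y a` is a linear map into Laurent series, `a_n b = 0` for `n` large, and the sums in the
Borcherds identity (the component form of the Jacobi identity) have finitely many nonzero terms. -/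
class VertexOperatorAlgebra (V : Type*) [AddCommGroup V] [Module ℂ V] where
  /-- the weight space `V_n` -/
  gr : ℕ → Submodule ℂ V
  isInternal : DirectSum.IsInternal gr
  finite_gr : ∀ n, FiniteDimensional ℂ (gr n)
  /-- the state-field correspondence -/
  Y : V →ₗ[ℂ] VertexOperator ℂ V
  /-- the vacuum vector -/
  vac : V
  /-- the conformal vector -/
  conf : V
  /-- the central charge -/
  charge : ℂ
  vac_mem : vac ∈ gr 0
  conf_mem : conf ∈ gr 2
  vac_mode : ∀ (n : ℤ) (b : V), modeOf Y n vac b = if n = -1 then b else 0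
  mode_vac_of_nonneg : ∀ (a : V) (n : ℤ), 0 ≤ n → modeOf Y n a vac = 0
  mode_neg_one_vac : ∀ a : V, modeOf Y (-1) a vac = a
  borcherds : ∀ (a b c : V) (m n k : ℤ),
    ∑ᶠ i : ℕ, Ring.choose m i • modeOf Y (m + k - i) (modeOf Y (n + i) a b) c =
    ∑ᶠ i : ℕ, ((-1) ^ i * Ring.choose n i) •
      (modeOf Y (m + n - i) a (modeOf Y (k + i) b c)
        - n.negOnePow • modeOf Y (n + k - i) b (modeOf Y (m + i) a c))
  /-- the Virasoro relations for `L(n) = ω_{n+1}` -/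
  virasoro : ∀ (m n : ℤ) (v : V),
    modeOf Y (m + 1) conf (modeOf Y (n + 1) conf v)
        - modeOf Y (n + 1) conf (modeOf Y (m + 1) conf v) =
      ((m : ℂ) - n) • modeOf Y (m + n + 1) conf v
        + (if m + n = 0 then (((m : ℂ) ^ 3 - m) / 12 * charge) • v else 0)
  /-- `L(0)` acts on `V_n` as `n` -/
  L_zero : ∀ (n : ℕ), ∀ v ∈ gr n, modeOf Y 1 conf v = (n : ℂ) • v
  /-- `Y(L(-1)a, z) = d/dz Y(a, z)` -/
  L_neg_one : ∀ (a : V) (n : ℤ) (b : V),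
    modeOf Y n (modeOf Y 0 conf a) b = (-n : ℂ) • modeOf Y (n - 1) a b

namespace VertexOperatorAlgebra

variable {V : Type*} [AddCommGroup V] [Module ℂ V] [VertexOperatorAlgebra V]

/-- `mode n a b` is `a_n b`. -/
noncomputable def mode (n : ℤ) : V →ₗ[ℂ] V →ₗ[ℂ] V :=
  modeOf Y n

/-- A vector is homogeneous if it lies in some weight space. -/
def IsHomogeneous (a : V) : Prop := ∃ n : ℕ, a ∈ gr (V := V) n

/-- `V` is strongly generated by `U` if it is spanned by the vectors
`a¹_{-n₁} ⋯ aʳ_{-nᵣ} 𝟏` with `r ≥ 0`, `aⁱ ∈ U` and `nᵢ ≥ 1`. -/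
def StronglyGeneratedBy (U : Set V) : Prop :=
  Submodule.span ℂ {v : V | ∃ l : List (V × ℕ), (∀ x ∈ l, x.1 ∈ U ∧ 1 ≤ x.2) ∧
    v = l.foldr (fun x w => mode (-(x.2 : ℤ)) x.1 w) vac} = ⊤

/-- `resProd p r a b = Res_z Y(a,z) b (1+z)^p z^r = ∑_{j=0}^p (p choose j) a_{j+r} b`. -/
noncomputable def resProd (p : ℕ) (r : ℤ) : V →ₗ[ℂ] V →ₗ[ℂ] V :=
  ∑ j ∈ Finset.range (p + 1), (p.choose j) • mode ((j : ℤ) + r)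

variable (V) in
/-- The decomposition of `V` into weight spaces, as a linear equivalence. -/
noncomputable def grEquiv : DirectSum ℕ (fun n => gr (V := V) n) ≃ₗ[ℂ] V :=
  LinearEquiv.ofBijective (DirectSum.coeLinearMap (gr (V := V))) isInternal

/-- Zhu's product: the bilinear map with
`a ∗ b = Res_z Y(a,z) b (1+z)^{wt a} / z` for homogeneous `a`. -/
noncomputable def zhuMul : V →ₗ[ℂ] V →ₗ[ℂ] V :=
  DirectSum.toModule ℂ ℕ (V →ₗ[ℂ] V)
      (fun p => resProd p (-1) ∘ₗ (gr (V := V) p).subtype) ∘ₗ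
    (grEquiv V).symm.toLinearMap

variable (V) in
/-- `O(V)`: the span of the elements `Res_z Y(a,z) b (1+z)^{wt a} / z²`
with `a` homogeneous. -/
noncomputable def zhuO : Submodule ℂ V :=
  Submodule.span ℂ {v : V | ∃ p : ℕ, ∃ a ∈ gr (V := V) p, ∃ b : V, v = resProd p (-2) a b}

/-! ### `O(V)` is a two-sided ideal and the product is associative modulo `O(V)` -/

theorem mode_apply (n : ℤ) (a b : V) : mode n a b = modeOf Y n a b := rfl

theorem mode_trunc (a b : V) : ∃ N : ℤ, ∀ n, N ≤ n → mode n a b = 0 :=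
  ⟨-HahnSeries.order ((HahnModule.of ℂ).symm (Y a b)), fun n hn => by
    exact VertexOperator.ncoeff_eq_zero_of_lt_order _ _ _ (by linarith)⟩

theorem resProd_apply (p : ℕ) (r : ℤ) (a b : V) : resProd p r a b =
    ∑ j ∈ Finset.range (p + 1), (p.choose j) • mode ((j : ℤ) + r) a b := by
  simp [resProd, LinearMap.sum_apply]

theorem grEquiv_of (p : ℕ) (a : gr (V := V) p) :
    grEquiv V (DirectSum.of (fun n => gr (V := V) n) p a) = (a : V) :=
  DirectSum.coeLinearMap_of (gr (V := V)) p a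

theorem zhuMul_of_mem {p : ℕ} {a : V} (ha : a ∈ gr (V := V) p) (b : V) :
    zhuMul a b = resProd p (-1) a b := by
  have h : (grEquiv V).symm a = DirectSum.lof ℂ ℕ (fun i => gr (V := V) i) p ⟨a, ha⟩ := by
    rw [LinearEquiv.symm_apply_eq]
    exact (grEquiv_of p ⟨a, ha⟩).symm
  simp [zhuMul, h, DirectSum.toModule_lof]

/-- Pascal's rule. -/
theorem resProd_succ (p : ℕ) (r : ℤ) (a b : V) :
    resProd (p + 1) r a b = resProd p r a b + resProd p (r + 1) a b := by
  simp only [resProd_apply]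
  rw [Finset.sum_range_succ' _ (p + 1)]
  simp only [Nat.choose_succ_succ, add_smul, Finset.sum_add_distrib]
  have h := Finset.sum_range_succ' (fun j => p.choose j • mode ((j : ℤ) + r) a b) (p + 1)
  rw [Finset.sum_range_succ _ (p + 1), Nat.choose_succ_self, zero_smul, add_zero] at h
  rw [h, Nat.choose_zero_right, Nat.choose_zero_right, add_assoc, add_comm]
  congr 1
  refine Finset.sum_congr rfl fun j _ => ?_
  have e : ((j + 1 : ℕ) : ℤ) + r = j + (r + 1) := by push_cast; ring
  rw [e]

theorem sum_mul_choose (p : ℕ) (r : ℤ) (a b : V) :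
    ∑ j ∈ Finset.range (p + 2), ((j : ℂ) * ((p + 1).choose j : ℂ)) • mode ((j : ℤ) + r) a b =
      ((p : ℂ) + 1) • resProd p (r + 1) a b := by
  rw [Finset.sum_range_succ', resProd_apply, Finset.smul_sum]
  simp only [Nat.cast_zero, zero_mul, zero_smul, add_zero]
  refine Finset.sum_congr rfl fun j _ => ?_
  rw [← Nat.cast_smul_eq_nsmul ℂ, smul_smul]
  congr 1
  · have := Nat.add_one_mul_choose_eq p j
    have h2 : ((p : ℂ) + 1) * (p.choose j : ℂ) = ((p + 1).choose (j + 1) : ℂ) * (j + 1) := by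
      exact_mod_cast this
    rw [h2]
    push_cast
    ring
  · push_cast
    ring_nf

/-- `L(-1)` -/
noncomputable def T : V →ₗ[ℂ] V := mode 0 (conf : V)

theorem mode_T (a b : V) (n : ℤ) : mode n (T a) b = (-n : ℂ) • mode (n - 1) a b :=
  L_neg_one a n b

theorem comm_formula (a b c : V) (k : ℤ) :
    mode 0 a (mode k b c) - mode k b (mode 0 a c) = mode k (mode 0 a b) c := by
  have h := borcherds a b c 0 0 k
  rw [finsum_eq_single _ 0, finsum_eq_single _ 0] at h
  · simpa [mode_apply] using h.symm
  · intro i hi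
    simp [Ring.choose_zero_pos ℤ (Nat.pos_of_ne_zero hi)]
  · intro i hi
    simp [Ring.choose_zero_pos ℤ (Nat.pos_of_ne_zero hi)]

theorem comm_formula_one (a b c : V) (k : ℤ) :
    mode 1 a (mode k b c) - mode k b (mode 1 a c) =
      mode (k + 1) (mode 0 a b) c + mode k (mode 1 a b) c := by
  have h := borcherds a b c 1 0 k
  rw [finsum_eq_sum_of_support_subset (s := Finset.range 2), finsum_eq_single _ 0] at h
  · simp [mode_apply, Finset.sum_range_succ] at h ⊢
    rw [← h, add_comm 1 k]
  · intro i hi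
    simp [Ring.choose_zero_pos ℤ (Nat.pos_of_ne_zero hi)]
  · intro i hi
    by_contra hi'
    simp only [Finset.coe_range, Set.mem_Iio, not_lt] at hi'
    apply hi
    have : Ring.choose (1 : ℤ) i = 0 := by
      have := Ring.choose_natCast (R := ℤ) 1 i
      rw [Nat.cast_one] at this
      rw [this, Nat.choose_eq_zero_of_lt (by omega)]
      simp
    simp [this]

theorem mem_gr_of_L_zero {v : V} {s : ℤ} (h : mode 1 conf v = (s : ℂ) • v) :
    (∀ n : ℕ, (n : ℤ) = s → v ∈ gr (V := V) n) ∧ (s < 0 → v = 0) := by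
  classical
  let e := grEquiv V
  obtain ⟨x, rfl⟩ := e.surjective v
  have key : ∀ y : DirectSum ℕ (fun i => gr (V := V) i), ∃ z : DirectSum ℕ (fun i => gr (V := V) i),
      mode 1 conf (e y) = e z ∧ ∀ i, z i = (i : ℂ) • y i := by
    intro y
    induction y using DirectSum.induction_on with
    | zero => exact ⟨0, by simp, by simp⟩
    | of i y =>
      refine ⟨DirectSum.of _ i ((i : ℂ) • y), ?_, ?_⟩
      · have h1 : ∀ w : gr (V := V) i, e (DirectSum.of _ i w) = (w : V) := fun w =>
          grEquiv_of i w
        rw [h1, h1]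
        exact L_zero i _ y.2
      · intro j
        by_cases hij : i = j
        · subst hij; simp
        · simp [DirectSum.of_eq_of_ne _ _ _ (Ne.symm hij)]
    | add y₁ y₂ h₁ h₂ =>
      obtain ⟨z₁, h₁, h₁'⟩ := h₁
      obtain ⟨z₂, h₂, h₂'⟩ := h₂
      exact ⟨z₁ + z₂, by simp [h₁, h₂], fun i => by simp [h₁', h₂']⟩
  obtain ⟨z, hz, hz'⟩ := key x
  rw [hz, ← map_smul] at h
  have h' := e.injective h
  have h0 : ∀ i : ℕ, (i : ℤ) ≠ s → x i = 0 := by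
    intro i hi
    have := hz' i
    rw [h'] at this
    have h3 : (s : ℂ) • x i = (i : ℂ) • x i := this
    have h4 : ((s : ℂ) - i) • x i = 0 := by rw [sub_smul, h3, sub_self]
    refine (smul_eq_zero.mp h4).resolve_left ?_
    refine sub_ne_zero.2 ?_
    exact_mod_cast hi.symm
  constructor
  · intro n hn
    have : x = DirectSum.of _ n (x n) := by
      refine DFinsupp.ext fun j => ?_
      by_cases hj : n = j
      · subst hj; exact (DirectSum.of_eq_same (β := fun i => gr (V := V) i) _ _).symm
      · exact (h0 j (by omega)).trans 
          (DirectSum.of_eq_of_ne (β := fun i => gr (V := V) i) _ _ _ (Ne.symm hj)).symm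
    rw [this]
    have h1 : e (DirectSum.of _ n (x n)) = ((x n : gr (V := V) n) : V) :=
      grEquiv_of n (x n)
    rw [h1]
    exact (x n).2
  · intro hs
    have : x = 0 := DFinsupp.ext fun j => h0 j (by omega)
    simp [this]

theorem L_zero_mode {p q : ℕ} {a b : V} (ha : a ∈ gr (V := V) p) (hb : b ∈ gr (V := V) q)
    (k : ℤ) : mode 1 conf (mode k a b) = ((p + q - k - 1 : ℤ) : ℂ) • mode k a b := by
  have h := comm_formula_one conf a b k
  have h1 : mode 1 conf a = (p : ℂ) • a := L_zero p a ha
  have h2 : mode 1 conf b = (q : ℂ) • b := L_zero q b hb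
  have h3 : mode (k + 1) (mode 0 conf a) b = (-(k + 1 : ℤ) : ℂ) • mode k a b := by
    have := mode_T a b (k + 1)
    rwa [add_sub_cancel_right] at this
  rw [h1, h2, h3, map_smul, map_smul, LinearMap.smul_apply, sub_eq_iff_eq_add] at h
  rw [h, ← add_smul, ← add_smul]
  congr 1
  push_cast
  ring

theorem mode_mem {p q s : ℕ} {a b : V} (ha : a ∈ gr (V := V) p) (hb : b ∈ gr (V := V) q)
    {k : ℤ} (hs : (s : ℤ) = p + q - k - 1) : mode k a b ∈ gr (V := V) s :=
  (mem_gr_of_L_zero (L_zero_mode ha hb k)).1 s hs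

theorem T_mem {p : ℕ} {a : V} (ha : a ∈ gr (V := V) p) : T a ∈ gr (V := V) (p + 1) :=
  mode_mem conf_mem ha (by push_cast; ring)

theorem homogeneous_induction {P : V → Prop} (h0 : P 0) (hadd : ∀ x y, P x → P y → P (x + y))
    (hgr : ∀ p : ℕ, ∀ a ∈ gr (V := V) p, P a) (a : V) : P a := by
  have h : a ∈ ⨆ i, gr (V := V) i := by
    rw [isInternal.submodule_iSup_eq_top]
    trivial
  exact Submodule.iSup_induction _ (motive := P) h hgr h0 hadd

theorem resProd_T (p : ℕ) (r : ℤ) (a b : V) : resProd (p + 1) r (T a) b =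
    (-r : ℂ) • resProd (p + 1) (r - 1) a b - ((p : ℂ) + 1) • resProd p r a b := by
  have h := sum_mul_choose p (r - 1) a b
  rw [sub_add_cancel] at h
  rw [← h, resProd_apply, resProd_apply, Finset.smul_sum, ← Finset.sum_sub_distrib]
  refine Finset.sum_congr rfl fun j _ => ?_
  rw [mode_T, ← Nat.cast_smul_eq_nsmul ℂ, ← Nat.cast_smul_eq_nsmul ℂ, smul_smul, smul_smul,
    add_sub_assoc, ← sub_smul]
  congr 1
  push_cast
  ring

theorem resProd_mem_aux (m : ℕ) : ∀ {p : ℕ} {a : V}, a ∈ gr (V := V) p → ∀ b : V,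
    resProd p (-2 - m) a b ∈ zhuO V := by
  induction m with
  | zero =>
    intro p a ha b
    exact Submodule.subset_span ⟨p, a, ha, b, by simp⟩
  | succ m ih =>
    intro p a ha b
    have h := ih (T_mem ha) b
    rw [resProd_T, resProd_succ, sub_add_cancel, smul_add, add_sub_assoc] at h
    have h2 := ih ha b
    have h3 := (Submodule.add_mem_iff_left _ (Submodule.sub_mem _
      (Submodule.smul_mem _ _ h2) (Submodule.smul_mem _ _ h2))).1 h
    have hne : (-((-2 - m : ℤ) : ℂ)) ≠ 0 := by
      have : (-2 - (m : ℤ)) ≠ 0 := by omega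
      exact neg_ne_zero.2 (by exact_mod_cast this)
    have h4 := (Submodule.smul_mem_iff _ hne).1 h3
    have h5 : (-2 - (m : ℤ) - 1) = -2 - ((m + 1 : ℕ) : ℤ) := by push_cast; ring
    rwa [h5] at h4

theorem resProd_mem (n : ℕ) : ∀ {m : ℕ}, n ≤ m → ∀ {p : ℕ} {a : V}, a ∈ gr (V := V) p → ∀ b : V,
    resProd (p + n) (-2 - m) a b ∈ zhuO V := by
  induction n with
  | zero => intro m _ p a ha b; exact resProd_mem_aux m ha b
  | succ n ih =>
    intro m hm p a ha b
    rw [← add_assoc, resProd_succ]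
    refine Submodule.add_mem _ (ih (by omega) ha b) ?_
    have h5 : (-2 - (m : ℤ) + 1) = -2 - ((m - 1 : ℕ) : ℤ) := by omega
    rw [h5]
    exact ih (by omega) ha b

/-- The Borcherds identity with `m, k + l` in place of `m, k`, as finite sums. -/
theorem borcherds_sum (a b c : V) (n k : ℤ) (P : ℕ) : ∃ N : ℕ, P < N ∧ ∀ m l : ℕ,
    ∑ i ∈ Finset.range N, (m.choose i) • mode (m + (k + l) - i) (mode (n + i) a b) c =
    ∑ i ∈ Finset.range N, ((-1) ^ i * Ring.choose n i) •
      (mode (m + n - i) a (mode (k + l + i) b c)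
        - n.negOnePow • mode (n + (k + l) - i) b (mode (m + i) a c)) := by
  obtain ⟨N₁, h₁⟩ := mode_trunc a b
  obtain ⟨N₂, h₂⟩ := mode_trunc b c
  obtain ⟨N₃, h₃⟩ := mode_trunc a c
  let N := P + 1 + (N₁ - n).toNat + (N₂ - k).toNat + N₃.toNat
  refine ⟨N, by omega, fun m l => ?_⟩
  have h := borcherds a b c m n (k + l)
  rw [finsum_eq_sum_of_support_subset (s := Finset.range N),
    finsum_eq_sum_of_support_subset (s := Finset.range N)] at h
  · simpa [mode_apply, Ring.choose_natCast] using h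
  · intro i hi
    by_contra hi'
    simp only [Finset.coe_range, Set.mem_Iio, not_lt] at hi'
    apply hi
    have e₂ := h₂ (k + l + i) (by omega)
    have e₃ := h₃ (m + i) (by omega)
    rw [mode_apply] at e₂ e₃
    simp [e₂, e₃]
  · intro i hi
    by_contra hi'
    simp only [Finset.coe_range, Set.mem_Iio, not_lt] at hi'
    apply hi
    have e₁ := h₁ (n + i) (by omega)
    rw [mode_apply] at e₁
    simp [e₁]

/-- `∑_{m,l} (P choose m) (Q choose l) (m choose i) x_{m+l+k-i} =
(P choose i) Res (1+z)^{P-i+Q} z^k`. -/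
theorem sum_resProd (P Q i : ℕ) (hi : i ≤ P) (k : ℤ) (x c : V) :
    ∑ m ∈ Finset.range (P + 1), ∑ l ∈ Finset.range (Q + 1), (P.choose m) • (Q.choose l) •
      (m.choose i) • mode (m + (k + l) - i) x c = (P.choose i) • resProd (P - i + Q) k x c := by
  have hQ : ∀ (Q R : ℕ) (k : ℤ), resProd (R + Q) k x c =
      ∑ l ∈ Finset.range (Q + 1), (Q.choose l) • resProd R (k + l) x c := by
    intro Q R
    induction R with
    | zero => intro k; simp [resProd_apply, add_comm]
    | succ R ih =>
      intro k
      rw [add_right_comm, resProd_succ, ih, ih, ← Finset.sum_add_distrib]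
      refine Finset.sum_congr rfl fun l _ => ?_
      rw [resProd_succ, smul_add, add_right_comm k]
  rw [hQ, Finset.sum_comm, Finset.smul_sum]
  refine Finset.sum_congr rfl fun l _ => ?_
  rw [resProd_apply, Finset.smul_sum, Finset.smul_sum]
  obtain ⟨R, rfl⟩ := Nat.exists_eq_add_of_le hi
  rw [Nat.add_sub_cancel_left, add_assoc, Finset.sum_range_add, Finset.sum_eq_zero, zero_add]
  · refine Finset.sum_congr rfl fun j _ => ?_
    have h := Nat.choose_mul (n := i + R) (k := i + j) (s := i) (by omega)
    rw [Nat.add_sub_cancel_left, Nat.add_sub_cancel_left] at h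
    rw [smul_comm (Q.choose l) (Nat.choose (i + j) i), ← mul_smul, h, mul_smul,
      smul_comm (R.choose j)]
    have e : ((i + j : ℕ) : ℤ) + (k + l) - i = j + (k + l) := by push_cast; ring
    rw [e]
  · intro m hm
    rw [Nat.choose_eq_zero_of_lt (Finset.mem_range.1 hm)]
    simp

/-- The residue of the Jacobi identity against `(1+z)^P (1+w)^Q w^k (z-w)^n`. -/
theorem jacobi_resProd (a b c : V) (n k : ℤ) (P Q : ℕ) : ∃ N : ℕ, 0 < N ∧
    ∑ i ∈ Finset.range (P + 1),
      (P.choose i) • resProd (P - i + Q) k (mode (i + n) a b) c =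
    ∑ i ∈ Finset.range N, ((-1) ^ i * Ring.choose n i) •
      (resProd P (n - i) a (resProd Q (k + i) b c)
        - n.negOnePow • resProd Q (n + k - i) b (resProd P i a c)) := by
  obtain ⟨N, hN, h⟩ := borcherds_sum a b c n k P
  refine ⟨N, by omega, ?_⟩
  have h' : ∑ m ∈ Finset.range (P + 1), ∑ l ∈ Finset.range (Q + 1), (P.choose m) • (Q.choose l) •
      ∑ i ∈ Finset.range N, (m.choose i) • mode (m + (k + l) - i) (mode (n + i) a b) c =
      ∑ m ∈ Finset.range (P + 1), ∑ l ∈ Finset.range (Q + 1), (P.choose m) • (Q.choose l) •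
      ∑ i ∈ Finset.range N, ((-1) ^ i * Ring.choose n i) •
      (mode (m + n - i) a (mode (k + l + i) b c)
        - n.negOnePow • mode (n + (k + l) - i) b (mode (m + i) a c)) :=
    Finset.sum_congr rfl fun m _ => Finset.sum_congr rfl fun l _ => by rw [h]
  have swap : ∀ F : ℕ → ℕ → ℕ → V,
      ∑ m ∈ Finset.range (P + 1), ∑ l ∈ Finset.range (Q + 1), (P.choose m) • (Q.choose l) •
        ∑ i ∈ Finset.range N, F m l i =
      ∑ i ∈ Finset.range N, ∑ m ∈ Finset.range (P + 1), ∑ l ∈ Finset.range (Q + 1),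
        (P.choose m) • (Q.choose l) • F m l i := by
    intro F
    simp only [Finset.smul_sum]
    rw [Finset.sum_comm]
    rw [Finset.sum_congr rfl fun l _ => Finset.sum_comm]
    rw [Finset.sum_comm]
    exact Finset.sum_congr rfl fun i _ => Finset.sum_comm
  rw [swap, swap] at h'
  have hL : ∑ i ∈ Finset.range (P + 1),
      (P.choose i) • resProd (P - i + Q) k (mode (i + n) a b) c =
      ∑ i ∈ Finset.range N, ∑ m ∈ Finset.range (P + 1), ∑ l ∈ Finset.range (Q + 1),
        (P.choose m) • (Q.choose l) •
          (m.choose i) • mode (m + (k + l) - i) (mode (n + i) a b) c := by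
    rw [← Finset.sum_subset (Finset.range_subset_range.2 (Nat.succ_le_of_lt hN))]
    · refine Finset.sum_congr rfl fun i hi => ?_
      rw [sum_resProd P Q i (by simpa [Nat.lt_succ_iff] using hi), add_comm n]
    · intro i _ hi
      refine Finset.sum_eq_zero fun m hm => Finset.sum_eq_zero fun l _ => ?_
      simp only [Finset.mem_range, not_lt] at hi hm
      rw [Nat.choose_eq_zero_of_lt (n := m) (k := i) (by omega)]
      simp
  rw [hL, h']
  refine Finset.sum_congr rfl fun i _ => ?_
  have e1 : resProd P (n - i) a (resProd Q (k + i) b c) =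
      ∑ m ∈ Finset.range (P + 1), ∑ l ∈ Finset.range (Q + 1), (P.choose m) • (Q.choose l) •
        mode (m + n - i) a (mode (k + l + i) b c) := by
    rw [resProd_apply]
    refine Finset.sum_congr rfl fun m _ => ?_
    rw [resProd_apply, map_sum, Finset.smul_sum]
    refine Finset.sum_congr rfl fun l _ => ?_
    have e : (l : ℤ) + (k + i) = k + l + i := by ring
    rw [map_nsmul, add_sub_assoc, e]
  have e2 : resProd Q (n + k - i) b (resProd P i a c) =
      ∑ m ∈ Finset.range (P + 1), ∑ l ∈ Finset.range (Q + 1), (P.choose m) • (Q.choose l) •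
        mode (n + (k + l) - i) b (mode (m + i) a c) := by
    rw [resProd_apply, Finset.sum_comm]
    refine Finset.sum_congr rfl fun l _ => ?_
    rw [resProd_apply, map_sum, Finset.smul_sum]
    refine Finset.sum_congr rfl fun m _ => ?_
    rw [map_nsmul, smul_comm]
    have e : (l : ℤ) + (n + k - i) = n + (k + l) - i := by ring
    rw [e]
  rw [e1, e2]
  simp only [Finset.smul_sum, ← Finset.sum_sub_distrib]
  refine Finset.sum_congr rfl fun m _ => Finset.sum_congr rfl fun l _ => ?_
  rw [smul_comm (Q.choose l), smul_comm (P.choose m), smul_sub, smul_sub,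
    smul_comm (Q.choose l) n.negOnePow, smul_comm (P.choose m) n.negOnePow]

theorem zhuO_mul_of_mem {p q : ℕ} {a b : V} (ha : a ∈ gr (V := V) p) (hb : b ∈ gr (V := V) q)
    (c : V) : zhuMul (resProd p (-2) a b) c ∈ zhuO V := by
  obtain ⟨N, -, h⟩ := jacobi_resProd a b c (-2) (-1) p (q + 1)
  have hL : zhuMul (resProd p (-2) a b) c = ∑ i ∈ Finset.range (p + 1),
      (p.choose i) • resProd (p - i + (q + 1)) (-1) (mode (i + (-2)) a b) c := by
    rw [resProd_apply, map_sum, LinearMap.sum_apply]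
    refine Finset.sum_congr rfl fun i hi => ?_
    rw [map_nsmul, LinearMap.smul_apply, zhuMul_of_mem (mode_mem ha hb _)]
    have := Finset.mem_range.1 hi
    omega
  rw [hL, h]
  refine Submodule.sum_mem _ fun i _ => zsmul_mem (Submodule.sub_mem _ ?_ ?_) _
  · exact resProd_mem_aux i ha _
  · have : (-2 + -1 - (i : ℤ)) = -2 - ((i + 1 : ℕ) : ℤ) := by push_cast; ring
    rw [this, Units.smul_def]
    exact zsmul_mem (resProd_mem 1 (by omega) hb _) _

theorem zhuO_mul {x : V} (hx : x ∈ zhuO V) (c : V) : zhuMul x c ∈ zhuO V := by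
  have : zhuO V ≤ (zhuO V).comap (zhuMul.flip c) := by
    rw [zhuO, Submodule.span_le]
    rintro _ ⟨p, a, ha, b, rfl⟩
    change zhuMul (resProd p (-2) a b) c ∈ zhuO V
    induction b using homogeneous_induction with
    | h0 => simp
    | hadd x y hx hy =>
      rw [map_add, map_add, LinearMap.add_apply]
      exact Submodule.add_mem _ hx hy
    | hgr q b hb => exact zhuO_mul_of_mem ha hb c
  exact this hx

theorem zhuMul_assoc_of_mem {p q : ℕ} {a b : V} (ha : a ∈ gr (V := V) p)
    (hb : b ∈ gr (V := V) q) (c : V) :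
    zhuMul (zhuMul a b) c - zhuMul a (zhuMul b c) ∈ zhuO V := by
  obtain ⟨N, hN, h⟩ := jacobi_resProd a b c (-1) (-1) p q
  have hL : zhuMul (zhuMul a b) c = ∑ i ∈ Finset.range (p + 1),
      (p.choose i) • resProd (p - i + q) (-1) (mode (i + (-1)) a b) c := by
    rw [zhuMul_of_mem ha, resProd_apply, map_sum, LinearMap.sum_apply]
    refine Finset.sum_congr rfl fun i hi => ?_
    rw [map_nsmul, LinearMap.smul_apply, zhuMul_of_mem (mode_mem ha hb _)]
    have := Finset.mem_range.1 hi
    omega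
  have hsecond : ∀ i : ℕ, resProd q (-1 + -1 - (i : ℤ)) b (resProd p i a c) ∈ zhuO V := fun i =>
    resProd_mem_aux i hb _
  obtain ⟨M, rfl⟩ := Nat.exists_eq_succ_of_ne_zero hN.ne'
  rw [hL, h, Finset.sum_range_succ', zhuMul_of_mem ha, zhuMul_of_mem hb, add_sub_assoc]
  refine Submodule.add_mem _ (Submodule.sum_mem _ fun i _ =>
    zsmul_mem (Submodule.sub_mem _ ?_ ?_) _) ?_
  · have : (-1 - ((i + 1 : ℕ) : ℤ)) = -2 - (i : ℤ) := by push_cast; ring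
    rw [this]
    exact resProd_mem_aux i ha _
  · rw [Units.smul_def]
    exact zsmul_mem (hsecond _) _
  · have h0 := hsecond 0
    simp only [Nat.cast_zero, sub_zero, add_zero, pow_zero, Ring.choose_zero_right, mul_one,
      one_smul] at h0 ⊢
    rw [sub_sub_cancel_left, Units.smul_def]
    exact neg_mem (zsmul_mem h0 _)

theorem zhuMul_assoc (a b c : V) :
    zhuMul (zhuMul a b) c - zhuMul a (zhuMul b c) ∈ zhuO V := by
  induction a using homogeneous_induction with
  | h0 => simp
  | hadd x y hx hy =>
    simp only [map_add, LinearMap.add_apply]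
    rw [add_sub_add_comm]
    exact Submodule.add_mem _ hx hy
  | hgr p a ha =>
    induction b using homogeneous_induction with
    | h0 => simp
    | hadd x y hx hy =>
      simp only [map_add, LinearMap.add_apply]
      rw [add_sub_add_comm]
      exact Submodule.add_mem _ hx hy
    | hgr q b hb => exact zhuMul_assoc_of_mem ha hb c

theorem vac_zhuMul (b : V) : zhuMul vac b = b := by
  rw [zhuMul_of_mem vac_mem, resProd_apply]
  simp [mode_apply, vac_mode]

theorem resProd_vac (p : ℕ) (a : V) : resProd p (-1) a vac = a := by
  rw [resProd_apply, Finset.sum_range_succ', Finset.sum_eq_zero]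
  · have := mode_neg_one_vac a
    rw [← mode_apply] at this
    simpa using this
  · intro i _
    rw [mode_apply, mode_vac_of_nonneg a _ (by push_cast; omega), smul_zero]

theorem zhuMul_vac (a : V) : zhuMul a vac = a := by
  induction a using homogeneous_induction with
  | h0 => simp
  | hadd x y hx hy => rw [map_add, LinearMap.add_apply, hx, hy]
  | hgr p a ha => rw [zhuMul_of_mem ha, resProd_vac]

theorem zhuMul_T_add {q : ℕ} {b : V} (hb : b ∈ gr (V := V) q) (c : V) :
    zhuMul (T b + (q : ℂ) • b) c = resProd q (-2) b c := by
  rw [map_add, map_smul, LinearMap.add_apply, LinearMap.smul_apply, zhuMul_of_mem (T_mem hb),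
    zhuMul_of_mem hb, resProd_T, resProd_succ]
  norm_num
  module

theorem T_add_mem {q : ℕ} {b : V} (hb : b ∈ gr (V := V) q) : T b + (q : ℂ) • b ∈ zhuO V := by
  rw [← zhuMul_vac (T b + _), zhuMul_T_add hb]
  exact resProd_mem_aux 0 hb vac

theorem mul_T_add_mem {p q : ℕ} {a b : V} (ha : a ∈ gr (V := V) p) (hb : b ∈ gr (V := V) q) :
    zhuMul a (T b + (q : ℂ) • b) ∈ zhuO V := by
  have hT : ∀ j : ℤ, mode j a (T b) = T (mode j a b) - mode j (T a) b := fun j => by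
    have := comm_formula conf a b j
    rw [eq_sub_iff_add_eq, add_comm, ← eq_sub_iff_add_eq]
    exact this.symm
  have h1 : ∀ j ∈ Finset.range (p + 1), p.choose j •
      (T (mode (j + (-1)) a b) + ((p : ℂ) + q - j) • mode (j + (-1)) a b) ∈ zhuO V := by
    intro j hj
    have hj := Finset.mem_range.1 hj
    refine nsmul_mem ?_ _
    have := T_add_mem (mode_mem (s := p + q - j) (k := j + (-1)) ha hb (by omega))
    rwa [Nat.cast_sub (by omega), Nat.cast_add] at this
  have h2 := Submodule.sum_mem _ h1
  have h3 : zhuMul a (T b + (q : ℂ) • b) =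
      (∑ j ∈ Finset.range (p + 1), p.choose j •
        (T (mode (j + (-1)) a b) + ((p : ℂ) + q - j) • mode (j + (-1)) a b))
      - resProd p (-2) a b := by
    have h4 : ∑ j ∈ Finset.range (p + 1), (p.choose j : ℂ) • ((p : ℂ) - j) • mode (j + (-1)) a b =
        ∑ j ∈ Finset.range (p + 1), ((j : ℂ) * (p.choose j : ℂ)) • mode (j + (-2)) a b := by
      rw [Finset.sum_range_succ, Finset.sum_range_succ']
      simp only [sub_self, zero_smul, smul_zero, add_zero, Nat.cast_zero, zero_mul]
      refine Finset.sum_congr rfl fun j hj => ?_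
      rw [smul_smul]
      have hj := Finset.mem_range.1 hj
      congr 1
      · have h5 := Nat.choose_succ_right_eq p j
        have h6 : (p.choose (j + 1) : ℂ) * (j + 1) = p.choose j * (p - j : ℕ) := by
          exact_mod_cast h5
        rw [Nat.cast_sub hj.le] at h6
        rw [← h6]
        push_cast
        ring
      · push_cast
        ring_nf
    rw [zhuMul_of_mem ha, resProd_apply, resProd_apply, ← Finset.sum_sub_distrib, ← sub_eq_zero,
      ← Finset.sum_sub_distrib]
    rw [← sub_eq_zero, ← Finset.sum_sub_distrib, ← neg_eq_zero, ← Finset.sum_neg_distrib] at h4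
    rw [← h4]
    refine Finset.sum_congr rfl fun j _ => ?_
    rw [map_add, map_smul, hT, mode_T]
    have e : (j : ℤ) + -1 - 1 = j + -2 := by ring
    rw [e]
    simp only [← Nat.cast_smul_eq_nsmul ℂ]
    push_cast
    module
  rw [h3]
  exact Submodule.sub_mem _ h2 (resProd_mem_aux 0 ha b)

theorem mul_zhuO (a : V) {x : V} (hx : x ∈ zhuO V) : zhuMul a x ∈ zhuO V := by
  have : zhuO V ≤ (zhuO V).comap (zhuMul a) := by
    rw [zhuO, Submodule.span_le]
    rintro _ ⟨q, b, hb, c, rfl⟩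
    change zhuMul a (resProd q (-2) b c) ∈ zhuO V
    rw [← zhuMul_T_add hb]
    have h := zhuMul_assoc a (T b + (q : ℂ) • b) c
    refine (Submodule.sub_mem_iff_right _ (zhuO_mul ?_ c)).1 h
    induction a using homogeneous_induction with
    | h0 => simp
    | hadd x y hx hy =>
      rw [map_add zhuMul, LinearMap.add_apply]
      refine Submodule.add_mem _ (hx (zhuMul_assoc _ _ _)) (hy (zhuMul_assoc _ _ _))
    | hgr p a ha => exact mul_T_add_mem ha hb
  exact this hx

variable (V) in
/-- Zhu's algebra `A(V) = V / O(V)`. -/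
def ZhuAlgebra : Type _ := V ⧸ zhuO V

namespace ZhuAlgebra

noncomputable instance : AddCommGroup (ZhuAlgebra V) :=
  inferInstanceAs (AddCommGroup (V ⧸ zhuO V))

noncomputable instance : Module ℂ (ZhuAlgebra V) :=
  inferInstanceAs (Module ℂ (V ⧸ zhuO V))

variable (V) in
/-- The projection `V → A(V)`. -/
noncomputable def mk : V →ₗ[ℂ] ZhuAlgebra V := (zhuO V).mkQ

theorem mk_surjective : Function.Surjective (mk V) := (zhuO V).mkQ_surjective

theorem mk_eq_iff {a b : V} : mk V a = mk V b ↔ a - b ∈ zhuO V := Submodule.Quotient.eq _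

/-- The product of `A(V)`, induced by Zhu's product on `V`. -/
noncomputable def mulMap : ZhuAlgebra V →ₗ[ℂ] ZhuAlgebra V →ₗ[ℂ] ZhuAlgebra V :=
  (zhuO V).liftQ
    { toFun := fun a => (zhuO V).liftQ (mk V ∘ₗ zhuMul a) (fun x hx => by
        rw [LinearMap.mem_ker, LinearMap.comp_apply, ← map_zero (mk V), mk_eq_iff, sub_zero]
        exact mul_zhuO a hx)
      map_add' := fun a b => by
        refine Submodule.linearMap_qext _ (LinearMap.ext fun x => ?_)
        change mk V (zhuMul (a + b) x) = mk V (zhuMul a x) + mk V (zhuMul b x)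
        simp
      map_smul' := fun r a => by
        refine Submodule.linearMap_qext _ (LinearMap.ext fun x => ?_)
        change mk V (zhuMul (r • a) x) = r • mk V (zhuMul a x)
        simp }
    (fun x hx => by
      rw [LinearMap.mem_ker]
      refine Submodule.linearMap_qext _ (LinearMap.ext fun y => ?_)
      change mk V (zhuMul x y) = 0
      rw [← map_zero (mk V), mk_eq_iff, sub_zero]
      exact zhuO_mul hx y)

/-- The ring structure of `A(V)`: the product is induced by `zhuMul`, the unit is the class of
the vacuum. -/
noncomputable instance : Ring (ZhuAlgebra V) where
  __ := (inferInstance : AddCommGroup (ZhuAlgebra V))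
  mul x y := mulMap x y
  one := mk V vac
  left_distrib x y z := map_add (mulMap x) y z
  right_distrib x y z := by
    change mulMap (x + y) z = mulMap x z + mulMap y z
    rw [map_add, LinearMap.add_apply]
  zero_mul x := by
    change mulMap 0 x = 0
    rw [map_zero, LinearMap.zero_apply]
  mul_zero x := map_zero (mulMap x)
  mul_assoc x y z := by
    obtain ⟨a, rfl⟩ := mk_surjective x
    obtain ⟨b, rfl⟩ := mk_surjective y
    obtain ⟨c, rfl⟩ := mk_surjective z
    exact mk_eq_iff.2 (zhuMul_assoc a b c)
  one_mul x := by
    obtain ⟨a, rfl⟩ := mk_surjective x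
    exact congrArg (mk V) (vac_zhuMul a)
  mul_one x := by
    obtain ⟨a, rfl⟩ := mk_surjective x
    exact congrArg (mk V) (zhuMul_vac a)

theorem mk_mul_mk (a b : V) : mk V a * mk V b = mk V (zhuMul a b) := rfl

theorem one_eq : (1 : ZhuAlgebra V) = mk V vac := rfl

end ZhuAlgebra

end VertexOperatorAlgebra

/-!
Filter `A(V)` by weight. Modulo vectors of lower weight, `O(V)` kills `a_{-n-1} b` for `n ≥ 1`, and
`a_{-1} b` becomes the product of `a` and `b`, which is commutative by skew symmetry. Strong
generation therefore makes the associated graded algebra a quotient of the polynomial ring in the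
generators. Sending a left ideal of `A(V)` to the ideal of polynomials representing its leading
forms is strictly monotone, because the filtration starts in weight `0` and is exhaustive, so the
Hilbert basis theorem gives the ascending chain condition for left ideals.
-/

theorem iSupIndep_eq_of_le_of_iSup_eq_top {ι α : Type*} [CompleteLattice α] [IsModularLattice α]
    {s t : ι → α} (ht : iSupIndep t) (hst : s ≤ t) (hs : ⨆ i, s i = ⊤) : s = t := by
  refine le_antisymm hst fun i => ?_
  have hdisj : t i ⊓ ⨆ (j) (_ : j ≠ i), s j = ⊥ :=
    ((ht i).mono_right (iSup₂_mono fun j _ => hst j)).eq_bot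
  have hsplit : s i ⊔ ⨆ (j) (_ : j ≠ i), s j = ⊤ := by
    rw [← hs, iSup_split_single s i]
  calc t i = (s i ⊔ ⨆ (j) (_ : j ≠ i), s j) ⊓ t i := by rw [hsplit, top_inf_eq]
    _ = s i ⊔ (⨆ (j) (_ : j ≠ i), s j) ⊓ t i := sup_inf_assoc_of_le _ (hst i)
    _ ≤ s i := by rw [inf_comm, hdisj, sup_bot_eq]

section Filtration

variable {α : Type*} [PartialOrder α] (F : ℕ → α) {F_lt : ℕ → α}

theorem filtration_lt_zero [OrderBot α] [IsFiltration F F_lt] : F_lt 0 = ⊥ :=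
  le_bot_iff.1 <| IsFiltration.is_sup (F := F) ⊥ 0 fun _ hi => absurd hi (Nat.not_lt_zero _)

theorem filtration_lt_succ [IsFiltration F F_lt] (k : ℕ) : F_lt (k + 1) = F k :=
  le_antisymm
    (IsFiltration.is_sup (F k) (k + 1) fun _ hi => IsFiltration.mono (Nat.lt_succ_iff.1 hi))
    (IsFiltration.is_le k.lt_succ_self)

end Filtration

section FilteredAlgebra

variable {K A : Type*} [CommRing K] [Ring A] [Algebra K A]
  (F : ℕ → Submodule K A) {F_lt : ℕ → Submodule K A} [IsRingFiltration F F_lt]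

theorem mul_mem_filtration_lt_left {k l : ℕ} {y z : A}
    (hy : y ∈ F k) (hz : z ∈ F_lt l) : y * z ∈ F_lt (k + l) := by
  have hle : F_lt l ≤ (F_lt (k + l)).comap (LinearMap.mulLeft K y) :=
    IsFiltration.is_sup (F := F) _ l fun _ hi _ hz =>
      IsFiltration.is_le (F := F) (Nat.add_lt_add_left hi k) (SetLike.mul_mem_graded hy hz)
  exact hle hz

theorem mul_mem_filtration_lt_right {k l : ℕ} {y z : A}
    (hy : y ∈ F_lt k) (hz : z ∈ F l) : y * z ∈ F_lt (k + l) := by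
  have hle : F_lt k ≤ (F_lt (k + l)).comap (LinearMap.mulRight K z) :=
    IsFiltration.is_sup (F := F) _ k fun _ hi _ hy =>
      IsFiltration.is_le (F := F) (Nat.add_lt_add_right hi l) (SetLike.mul_mem_graded hy hz)
  exact hle hy

end FilteredAlgebra

section Quantization

variable {K R A : Type*} [CommRing K] [Semiring R] [Algebra K R] [Ring A] [Algebra K A]

/-- A linear map `φ` from a graded algebra `R = ⨁ 𝒜 k` to a filtered algebra `A` is a quantization
map if it induces a surjective homomorphism of graded algebras from `R` to the associated graded
algebra `⨁ F k / F_lt k` of `A`. As in `IsFiltration`, `F_lt k` is the part of degree less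
than `k`. -/
structure IsQuantizationMap (𝒜 : ℕ → Submodule K R) (F F_lt : ℕ → Submodule K A)
    (φ : R →ₗ[K] A) : Prop where
  map_mem : ∀ {k : ℕ} {r : R}, r ∈ 𝒜 k → φ r ∈ F k
  map_mul_sub_mem : ∀ {k l : ℕ} {r s : R}, r ∈ 𝒜 k → s ∈ 𝒜 l →
    φ (r * s) - φ r * φ s ∈ F_lt (k + l)
  le_sup_map : ∀ k, F k ≤ F_lt k ⊔ (𝒜 k).map φ

namespace IsQuantizationMap

variable {𝒜 : ℕ → Submodule K R} {F F_lt : ℕ → Submodule K A} {φ : R →ₗ[K] A}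

theorem exists_sub_map_mem (hφ : IsQuantizationMap 𝒜 F F_lt φ) {k : ℕ} {y : A} (hy : y ∈ F k) :
    ∃ r ∈ 𝒜 k, y - φ r ∈ F_lt k := by
  obtain ⟨u, hu, _, ⟨r, hr, rfl⟩, rfl⟩ := Submodule.mem_sup.1 (hφ.le_sup_map k hy)
  exact ⟨r, hr, by rwa [add_sub_cancel_right]⟩

theorem map_mul_sub_map_mul_mem [IsRingFiltration F F_lt] (hφ : IsQuantizationMap 𝒜 F F_lt φ)
    {k l : ℕ} {r s : R} {u : A} (hr : r ∈ 𝒜 k) (hs : s ∈ 𝒜 l) (hu : φ s - u ∈ F_lt l) :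
    φ (r * s) - φ r * u ∈ F_lt (k + l) := by
  have hsum := add_mem (hφ.map_mul_sub_mem hr hs)
    (mul_mem_filtration_lt_left F (hφ.map_mem hr) hu)
  rwa [mul_sub, sub_add_sub_cancel] at hsum

variable [GradedAlgebra 𝒜] [IsRingFiltration F F_lt]

/-- The ideal of leading forms of a left ideal `I`: it is the preimage of the associated graded
ideal of `I` under the homomorphism to the associated graded algebra induced by `φ`. -/
def leadingIdeal (hφ : IsQuantizationMap 𝒜 F F_lt φ) (I : Ideal A) : Ideal R where
  carrier := {r | ∀ k, ∃ u ∈ I, φ (DirectSum.decompose 𝒜 r k) - u ∈ F_lt k}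
  zero_mem' k := ⟨0, zero_mem I, by simp⟩
  add_mem' hr hs k := by
    obtain ⟨u, hu, hru⟩ := hr k
    obtain ⟨v, hv, hsv⟩ := hs k
    refine ⟨u + v, add_mem hu hv, ?_⟩
    rw [DirectSum.decompose_add, DirectSum.add_apply, Submodule.coe_add, map_add,
      add_sub_add_comm]
    exact add_mem hru hsv
  smul_mem' g r hr := by
    induction g using DirectSum.Decomposition.inductionOn 𝒜 with
    | zero => exact fun k => ⟨0, zero_mem I, by simp⟩
    | add g h hg hh =>
      intro k
      obtain ⟨u, hu, hgu⟩ := hg k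
      obtain ⟨v, hv, hhv⟩ := hh k
      refine ⟨u + v, add_mem hu hv, ?_⟩
      rw [add_smul, DirectSum.decompose_add, DirectSum.add_apply, Submodule.coe_add, map_add,
        add_sub_add_comm]
      exact add_mem hgu hhv
    | @homogeneous i g =>
      intro k
      rw [smul_eq_mul, DirectSum.coe_decompose_mul_of_left_mem 𝒜 k g.2]
      split_ifs with hik
      · obtain ⟨u, hu, hru⟩ := hr (k - i)
        refine ⟨φ g * u, I.mul_mem_left _ hu, ?_⟩
        have hmem := hφ.map_mul_sub_map_mul_mem g.2 (SetLike.coe_mem _) hru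
        rwa [Nat.add_sub_cancel' hik] at hmem
      · exact ⟨0, zero_mem I, by simp⟩

theorem mem_leadingIdeal_iff (hφ : IsQuantizationMap 𝒜 F F_lt φ) {I : Ideal A} {k : ℕ} {r : R}
    (hr : r ∈ 𝒜 k) : r ∈ hφ.leadingIdeal I ↔ ∃ u ∈ I, φ r - u ∈ F_lt k := by
  refine ⟨fun h => ?_, fun h l => ?_⟩
  · simpa only [DirectSum.decompose_of_mem_same 𝒜 hr] using h k
  · obtain rfl | hkl := eq_or_ne k l
    · rwa [DirectSum.decompose_of_mem_same 𝒜 hr]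
    · exact ⟨0, zero_mem I, by simp [DirectSum.decompose_of_mem_ne 𝒜 hr hkl]⟩

theorem leadingIdeal_mono (hφ : IsQuantizationMap 𝒜 F F_lt φ) : Monotone hφ.leadingIdeal :=
  fun _ _ hIJ _ hr k => (hr k).imp fun _ hu => ⟨hIJ hu.1, hu.2⟩

theorem exists_mem_sub_mem_of_leadingIdeal_le (hφ : IsQuantizationMap 𝒜 F F_lt φ) {I J : Ideal A}
    (hlead : hφ.leadingIdeal J ≤ hφ.leadingIdeal I) {k : ℕ} {y : A} (hy : y ∈ F k) (hyJ : y ∈ J) :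
    ∃ u ∈ I, y - u ∈ F_lt k := by
  obtain ⟨r, hr, hyr⟩ := hφ.exists_sub_map_mem hy
  have hrJ : r ∈ hφ.leadingIdeal J :=
    (hφ.mem_leadingIdeal_iff hr).2 ⟨y, hyJ, by rw [← neg_sub]; exact neg_mem hyr⟩
  obtain ⟨u, hu, hru⟩ := (hφ.mem_leadingIdeal_iff hr).1 (hlead hrJ)
  exact ⟨u, hu, by simpa only [sub_add_sub_cancel] using add_mem hyr hru⟩

theorem le_of_leadingIdeal_le (hφ : IsQuantizationMap 𝒜 F F_lt φ) (hF : ∀ y, ∃ k, y ∈ F k)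
    {I J : Ideal A} (hIJ : I ≤ J) (hlead : hφ.leadingIdeal J ≤ hφ.leadingIdeal I) : J ≤ I := by
  have hlt : ∀ k, ∀ y ∈ F_lt k, y ∈ J → y ∈ I := by
    intro k
    induction k with
    | zero =>
      intro y hy _
      rw [filtration_lt_zero F, Submodule.mem_bot] at hy
      exact hy ▸ zero_mem I
    | succ k ih =>
      intro y hy hyJ
      rw [filtration_lt_succ F] at hy
      obtain ⟨u, hu, hyu⟩ := hφ.exists_mem_sub_mem_of_leadingIdeal_le hlead hy hyJ
      rw [← sub_add_cancel y u]
      exact add_mem (ih _ hyu (sub_mem hyJ (hIJ hu))) hu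
  intro y hy
  obtain ⟨k, hk⟩ := hF y
  exact hlt (k + 1) y ((filtration_lt_succ F k).symm ▸ hk) hy

theorem leadingIdeal_strictMono (hφ : IsQuantizationMap 𝒜 F F_lt φ) (hF : ∀ y, ∃ k, y ∈ F k) :
    StrictMono hφ.leadingIdeal := fun _ _ hIJ =>
  lt_of_le_not_ge (hφ.leadingIdeal_mono hIJ.le) fun hlead =>
    hIJ.not_ge (hφ.le_of_leadingIdeal_le hF hIJ.le hlead)

theorem isNoetherianRing [IsNoetherianRing R] (hφ : IsQuantizationMap 𝒜 F F_lt φ)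
    (hF : ∀ y, ∃ k, y ∈ F k) : IsNoetherianRing A := by
  have hR : WellFoundedGT (Ideal R) := inferInstance
  exact isNoetherian_iff'.2 (hφ.leadingIdeal_strictMono hF).wellFoundedGT

end IsQuantizationMap

end Quantization

section AlmostCommutative

variable {K A σ : Type*} [CommRing K] [Ring A] [Algebra K A]

variable (K) in
/-- The span of the words of weight `k` in the elements `x i`, where `x i` has weight `w i`. -/
def wordSpan (x : σ → A) (w : σ → ℕ) (k : ℕ) : Submodule K A :=
  Submodule.span K ((fun l : List σ => (l.map x).prod) '' {l | (l.map w).sum = k})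

theorem list_prod_mem_wordSpan (x : σ → A) (w : σ → ℕ) (l : List σ) :
    (l.map x).prod ∈ wordSpan K x w (l.map w).sum :=
  Submodule.subset_span ⟨l, rfl, rfl⟩

theorem mul_mem_wordSpan {x : σ → A} {w : σ → ℕ} {k : ℕ} {y : A} (i : σ)
    (hy : y ∈ wordSpan K x w k) : x i * y ∈ wordSpan K x w (w i + k) := by
  have hle : wordSpan K x w k ≤ (wordSpan K x w (w i + k)).comap (LinearMap.mulLeft K (x i)) := by
    rw [wordSpan, Submodule.span_le]
    rintro _ ⟨l, rfl, rfl⟩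
    exact list_prod_mem_wordSpan x w (i :: l)
  exact hle hy

variable (K) in
/-- The linear map from polynomials to `A` that sends a monomial to the product of the
corresponding elements `x i`, taken in some order chosen for each monomial. -/
noncomputable def orderedEval (x : σ → A) : MvPolynomial σ K →ₗ[K] A :=
  (MvPolynomial.basisMonomials σ K).constr K fun α => ((Finsupp.toMultiset α).toList.map x).prod

theorem orderedEval_monomial (x : σ → A) (α : σ →₀ ℕ) :
    orderedEval K x (MvPolynomial.monomial α 1) = ((Finsupp.toMultiset α).toList.map x).prod := by
  have hconstr := (MvPolynomial.basisMonomials σ K).constr_basis K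
    (fun α => ((Finsupp.toMultiset α).toList.map x).prod) α
  rwa [MvPolynomial.coe_basisMonomials] at hconstr

theorem sum_map_toMultiset_toList (w : σ → ℕ) (α : σ →₀ ℕ) :
    ((Finsupp.toMultiset α).toList.map w).sum = Finsupp.weight w α := by
  rw [← Multiset.sum_coe, ← Multiset.map_coe, Multiset.coe_toList]
  induction α using Finsupp.induction_linear with
  | zero => simp
  | add f g hf hg => rw [map_add, map_add, Multiset.map_add, Multiset.sum_add, hf, hg]
  | single i m => simp [Finsupp.weight_single, Multiset.map_nsmul, Multiset.sum_nsmul]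

theorem weightedHomogeneousSubmodule_eq_span (w : σ → ℕ) (k : ℕ) :
    MvPolynomial.weightedHomogeneousSubmodule K w k =
      Submodule.span K ((fun α => MvPolynomial.monomial α 1) '' {α | Finsupp.weight w α = k}) := by
  rw [MvPolynomial.weightedHomogeneousSubmodule_eq_finsupp_supported]
  exact AddMonoidAlgebra.supported_eq_span_single _ _

theorem orderedEval_mem {F : ℕ → Submodule K A} [SetLike.GradedMonoid F] {x : σ → A} {w : σ → ℕ}
    (hx : ∀ i, x i ∈ F (w i)) {k : ℕ} {f : MvPolynomial σ K}
    (hf : f ∈ MvPolynomial.weightedHomogeneousSubmodule K w k) : orderedEval K x f ∈ F k := by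
  have hle : MvPolynomial.weightedHomogeneousSubmodule K w k ≤ (F k).comap (orderedEval K x) := by
    rw [weightedHomogeneousSubmodule_eq_span, Submodule.span_le]
    rintro _ ⟨α, rfl, rfl⟩
    rw [SetLike.mem_coe, Submodule.mem_comap, orderedEval_monomial, ← sum_map_toMultiset_toList]
    exact SetLike.list_prod_map_mem_graded _ w x fun i _ => hx i
  exact hle hf

variable {F F_lt : ℕ → Submodule K A} [IsRingFiltration F F_lt] {x : σ → A} {w : σ → ℕ}

theorem mul_mem_sup_wordSpan (hx : ∀ i, x i ∈ F (w i)) {k : ℕ} {y : A} (i : σ)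
    (hy : y ∈ F_lt k ⊔ wordSpan K x w k) :
    x i * y ∈ F_lt (w i + k) ⊔ wordSpan K x w (w i + k) := by
  obtain ⟨u, hu, v, hv, rfl⟩ := Submodule.mem_sup.1 hy
  rw [mul_add]
  exact Submodule.add_mem_sup (mul_mem_filtration_lt_left F (hx i) hu) (mul_mem_wordSpan i hv)

theorem prod_sub_prod_mem_filtration_lt (hx : ∀ i, x i ∈ F (w i))
    (hcomm : ∀ i j, x i * x j - x j * x i ∈ F_lt (w i + w j)) {l l' : List σ} (hl : l.Perm l') :
    (l.map x).prod - (l'.map x).prod ∈ F_lt (l.map w).sum := by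
  induction hl with
  | nil => simp
  | cons i _ ih =>
    simp only [List.map_cons, List.prod_cons, List.sum_cons, ← mul_sub]
    exact mul_mem_filtration_lt_left F (hx i) ih
  | swap i j l =>
    have hprod := SetLike.list_prod_map_mem_graded (A := F) l w x fun i _ => hx i
    simpa [sub_mul, mul_assoc, add_assoc] using
      mul_mem_filtration_lt_right F (hcomm j i) hprod
  | trans h₁ _ ih₁ ih₂ =>
    rw [← (h₁.map w).sum_eq] at ih₂
    simpa using add_mem ih₁ ih₂

theorem orderedEval_monomial_mul_sub_mem (hx : ∀ i, x i ∈ F (w i))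
    (hcomm : ∀ i j, x i * x j - x j * x i ∈ F_lt (w i + w j)) (α β : σ →₀ ℕ) :
    orderedEval K x (MvPolynomial.monomial α 1 * MvPolynomial.monomial β 1)
      - orderedEval K x (MvPolynomial.monomial α 1) * orderedEval K x (MvPolynomial.monomial β 1)
      ∈ F_lt (Finsupp.weight w α + Finsupp.weight w β) := by
  have hperm : (Finsupp.toMultiset (α + β)).toList.Perm
      ((Finsupp.toMultiset α).toList ++ (Finsupp.toMultiset β).toList) := by
    rw [← Multiset.coe_eq_coe, ← Multiset.coe_add]
    simp only [Multiset.coe_toList, map_add]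
  have hmem := prod_sub_prod_mem_filtration_lt hx hcomm hperm
  rwa [sum_map_toMultiset_toList, map_add, List.map_append, List.prod_append,
    ← orderedEval_monomial (K := K), ← orderedEval_monomial (K := K),
    ← orderedEval_monomial (K := K), ← one_mul (1 : K), ← MvPolynomial.monomial_mul,
    one_mul] at hmem

theorem orderedEval_mul_sub_mem (hx : ∀ i, x i ∈ F (w i))
    (hcomm : ∀ i j, x i * x j - x j * x i ∈ F_lt (w i + w j)) {k l : ℕ} {f g : MvPolynomial σ K}
    (hf : f ∈ MvPolynomial.weightedHomogeneousSubmodule K w k)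
    (hg : g ∈ MvPolynomial.weightedHomogeneousSubmodule K w l) :
    orderedEval K x (f * g) - orderedEval K x f * orderedEval K x g ∈ F_lt (k + l) := by
  rw [weightedHomogeneousSubmodule_eq_span] at hf hg
  induction hf, hg using Submodule.span_induction₂ with
  | mem_mem f g hf hg =>
    obtain ⟨α, rfl, rfl⟩ := hf
    obtain ⟨β, rfl, rfl⟩ := hg
    exact orderedEval_monomial_mul_sub_mem hx hcomm α β
  | zero_left | zero_right => simp
  | add_left f f' g _ _ _ hf hf' =>
    simpa only [add_mul, map_add, add_sub_add_comm] using add_mem hf hf'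
  | add_right f g g' _ _ _ hg hg' =>
    simpa only [mul_add, map_add, add_sub_add_comm] using add_mem hg hg'
  | smul_left c f g _ _ h | smul_right c f g _ _ h =>
    simpa only [smul_mul_assoc, mul_smul_comm, map_smul, ← smul_sub] using
      Submodule.smul_mem _ c h

theorem wordSpan_le_sup_map_orderedEval (hx : ∀ i, x i ∈ F (w i))
    (hcomm : ∀ i j, x i * x j - x j * x i ∈ F_lt (w i + w j)) (k : ℕ) :
    wordSpan K x w k ≤
      F_lt k ⊔ (MvPolynomial.weightedHomogeneousSubmodule K w k).map (orderedEval K x) := by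
  classical
  rw [wordSpan, Submodule.span_le]
  rintro _ ⟨l, rfl, rfl⟩
  let α : σ →₀ ℕ := Multiset.toFinsupp (l : Multiset σ)
  have hperm : l.Perm (Finsupp.toMultiset α).toList := by
    rw [← Multiset.coe_eq_coe, Multiset.coe_toList, Multiset.toFinsupp_toMultiset]
  have hα : MvPolynomial.IsWeightedHomogeneous w (MvPolynomial.monomial α (1 : K))
      (l.map w).sum :=
    MvPolynomial.isWeightedHomogeneous_monomial _ _ _ <| by
      rw [(hperm.map w).sum_eq, sum_map_toMultiset_toList]
  have hdiff := prod_sub_prod_mem_filtration_lt hx hcomm hperm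
  rw [← orderedEval_monomial (K := K)] at hdiff
  exact Submodule.mem_sup.2 ⟨_, hdiff, _, Submodule.mem_map_of_mem hα, sub_add_cancel _ _⟩

theorem isQuantizationMap_orderedEval (hx : ∀ i, x i ∈ F (w i))
    (hcomm : ∀ i j, x i * x j - x j * x i ∈ F_lt (w i + w j))
    (hspan : ∀ k, F k ≤ F_lt k ⊔ wordSpan K x w k) :
    IsQuantizationMap (MvPolynomial.weightedHomogeneousSubmodule K w) F F_lt (orderedEval K x) where
  map_mem := orderedEval_mem hx
  map_mul_sub_mem := orderedEval_mul_sub_mem hx hcomm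
  le_sup_map k :=
    (hspan k).trans (sup_le le_sup_left (wordSpan_le_sup_map_orderedEval hx hcomm k))

theorem isNoetherianRing_of_almostCommutative [IsNoetherianRing K] [Finite σ]
    (hx : ∀ i, x i ∈ F (w i)) (hcomm : ∀ i j, x i * x j - x j * x i ∈ F_lt (w i + w j))
    (hspan : ∀ k, F k ≤ F_lt k ⊔ wordSpan K x w k) (hF : ∀ y, ∃ k, y ∈ F k) :
    IsNoetherianRing A :=
  letI := MvPolynomial.weightedGradedAlgebra K w
  (isQuantizationMap_orderedEval hx hcomm hspan).isNoetherianRing hF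

end AlmostCommutative

namespace VertexOperatorAlgebra

variable {V : Type*} [AddCommGroup V] [Module ℂ V] [VertexOperatorAlgebra V]

theorem mode_neg_one_sub_mode_neg_one (a b : V) :
    mode (-1) a b - mode (-1) b a =
      ∑ᶠ i : ℕ, Ring.choose (-1 : ℤ) i • mode (-2 - i : ℤ) (mode i a b) vac := by
  have hborcherds := borcherds a b vac (-1) 0 (-1)
  have hpos : ∀ i : ℕ, i ≠ 0 → ((-1) ^ i * Ring.choose (0 : ℤ) i) •
      (modeOf Y (-1 + 0 - i) a (modeOf Y (-1 + i) b vac)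
        - (0 : ℤ).negOnePow • modeOf Y (0 + -1 - i) b (modeOf Y (-1 + i) a vac)) = 0 := by
    intro i hi
    rw [Ring.choose_zero_pos ℤ (Nat.pos_of_ne_zero hi), mul_zero, zero_smul]
  rw [finsum_eq_single _ 0 hpos] at hborcherds
  have hvac (c : V) : mode (-1) c vac = c := mode_neg_one_vac c
  simpa [← mode_apply, hvac] using hborcherds.symm

namespace ZhuAlgebra

noncomputable instance : Algebra ℂ (ZhuAlgebra V) :=
  Algebra.ofModule (fun r x y => LinearMap.map_smul₂ mulMap r x y)
    fun r x y => map_smul (mulMap x) r y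

variable (V) in
/-- The weight filtration of `A(V)`: the image in `A(V)` of the vectors of weight at most `k`. -/
noncomputable def weightLE (k : ℕ) : Submodule ℂ (ZhuAlgebra V) :=
  ⨆ j ≤ k, (gr (V := V) j).map (mk V)

variable (V) in
/-- The image in `A(V)` of the vectors of weight less than `k`. -/
noncomputable def weightLT (k : ℕ) : Submodule ℂ (ZhuAlgebra V) :=
  ⨆ j < k, (gr (V := V) j).map (mk V)

theorem mk_mem_weightLE {j k : ℕ} (hjk : j ≤ k) {a : V} (ha : a ∈ gr (V := V) j) :
    mk V a ∈ weightLE V k :=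
  le_iSup₂_of_le (f := fun j (_ : j ≤ k) => (gr (V := V) j).map (mk V)) j hjk le_rfl
    (Submodule.mem_map_of_mem ha)

theorem mk_mem_weightLT {j k : ℕ} (hjk : j < k) {a : V} (ha : a ∈ gr (V := V) j) :
    mk V a ∈ weightLT V k :=
  le_iSup₂_of_le (f := fun j (_ : j < k) => (gr (V := V) j).map (mk V)) j hjk le_rfl
    (Submodule.mem_map_of_mem ha)

instance : IsFiltration (weightLE V) (weightLT V) where
  mono _ _ hkl := iSup₂_le fun _ hj => Submodule.map_le_iff_le_comap.2 fun _ ha =>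
    mk_mem_weightLE (hj.trans hkl) ha
  is_le hkl := iSup₂_le fun _ hj => Submodule.map_le_iff_le_comap.2 fun _ ha =>
    mk_mem_weightLT (hj.trans_lt hkl) ha
  is_sup _ _ hB := iSup₂_le fun j hj => Submodule.map_le_iff_le_comap.2 fun _ ha =>
    hB j hj (mk_mem_weightLE le_rfl ha)

theorem exists_mem_weightLE (y : ZhuAlgebra V) : ∃ k, y ∈ weightLE V k := by
  obtain ⟨a, rfl⟩ := mk_surjective y
  induction a using homogeneous_induction with
  | h0 => exact ⟨0, by simp⟩
  | hadd a b ha hb =>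
    obtain ⟨k, hk⟩ := ha
    obtain ⟨l, hl⟩ := hb
    have hmono := IsFiltration.mono (F := weightLE V)
    refine ⟨max k l, ?_⟩
    rw [map_add]
    exact add_mem (hmono (le_max_left k l) hk) (hmono (le_max_right k l) hl)
  | hgr p a ha => exact ⟨p, mk_mem_weightLE le_rfl ha⟩

theorem mk_mode_mem_weightLT {p q N : ℕ} {a b : V} (ha : a ∈ gr (V := V) p)
    (hb : b ∈ gr (V := V) q) {k : ℤ} (hN : p + q - k - 1 < (N : ℤ)) :
    mk V (mode k a b) ∈ weightLT V N := by
  obtain hneg | hnonneg := lt_or_ge ((p : ℤ) + q - k - 1) 0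
  · rw [(mem_gr_of_L_zero (L_zero_mode ha hb k)).2 hneg, map_zero]
    exact zero_mem _
  · obtain ⟨s, hs⟩ := Int.eq_ofNat_of_zero_le hnonneg
    exact mk_mem_weightLT (by omega) (mode_mem ha hb hs.symm)

theorem mk_resProd_sub_mk_mode_mem {p q N : ℕ} {a b : V} (ha : a ∈ gr (V := V) p)
    (hb : b ∈ gr (V := V) q) (P : ℕ) {r : ℤ} (hN : p + q - r - 1 = (N : ℤ)) :
    mk V (resProd P r a b) - mk V (mode r a b) ∈ weightLT V N := by
  rw [resProd_apply, Finset.sum_range_succ', Nat.choose_zero_right, one_smul, Nat.cast_zero,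
    zero_add, map_add, add_sub_cancel_right, map_sum]
  refine sum_mem fun j _ => ?_
  rw [map_nsmul]
  exact nsmul_mem (mk_mode_mem_weightLT ha hb (by push_cast; omega)) _

theorem mk_mode_neg_two_sub_mem_weightLT {p q : ℕ} {a b : V} (ha : a ∈ gr (V := V) p)
    (hb : b ∈ gr (V := V) q) (m : ℕ) :
    mk V (mode (-2 - m) a b) ∈ weightLT V (p + q + m + 1) := by
  have hzero : mk V (resProd p (-2 - m) a b) = 0 := by
    rw [← map_zero (mk V), mk_eq_iff, sub_zero]
    exact resProd_mem_aux m ha b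
  have hsub := mk_resProd_sub_mk_mode_mem ha hb p (r := -2 - m) (N := p + q + m + 1)
    (by push_cast; ring)
  rwa [hzero, zero_sub, neg_mem_iff] at hsub

theorem mk_mul_mk_sub_mk_mode_mem {p q : ℕ} {a b : V} (ha : a ∈ gr (V := V) p)
    (hb : b ∈ gr (V := V) q) :
    mk V a * mk V b - mk V (mode (-1) a b) ∈ weightLT V (p + q) := by
  rw [mk_mul_mk, zhuMul_of_mem ha]
  exact mk_resProd_sub_mk_mode_mem ha hb p (by push_cast; ring)

theorem mk_mode_neg_one_sub_mem {p q : ℕ} {a b : V} (ha : a ∈ gr (V := V) p)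
    (hb : b ∈ gr (V := V) q) :
    mk V (mode (-1) a b) - mk V (mode (-1) b a) ∈ weightLT V (p + q) := by
  rw [← map_sub, mode_neg_one_sub_mode_neg_one]
  refine finsum_induction (fun v => mk V v ∈ weightLT V (p + q)) (by simp)
    (fun u v hu hv => by rw [map_add]; exact add_mem hu hv) fun i => ?_
  rw [map_zsmul]
  refine zsmul_mem ?_ _
  obtain hneg | hnonneg := lt_or_ge ((p : ℤ) + q - i - 1) 0
  · simp [(mem_gr_of_L_zero (L_zero_mode ha hb i)).2 hneg]
  · obtain ⟨s, hs⟩ := Int.eq_ofNat_of_zero_le hnonneg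
    have hweight : s + 0 + i + 1 = p + q := by omega
    exact hweight ▸ mk_mode_neg_two_sub_mem_weightLT (mode_mem ha hb hs.symm) vac_mem i

theorem mk_mul_mk_sub_mul_mem {p q : ℕ} {a b : V} (ha : a ∈ gr (V := V) p)
    (hb : b ∈ gr (V := V) q) :
    mk V a * mk V b - mk V b * mk V a ∈ weightLT V (p + q) := by
  have hab := mk_mul_mk_sub_mk_mode_mem ha hb
  have hba := mk_mul_mk_sub_mk_mode_mem hb ha
  rw [add_comm q p] at hba
  have hsum := sub_mem (add_mem hab (mk_mode_neg_one_sub_mem ha hb)) hba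
  rwa [sub_add_sub_cancel, sub_sub_sub_cancel_right] at hsum

theorem mk_mul_mk_mem_weightLE {p q : ℕ} {a b : V} (ha : a ∈ gr (V := V) p)
    (hb : b ∈ gr (V := V) q) : mk V a * mk V b ∈ weightLE V (p + q) := by
  rw [← sub_add_cancel (mk V a * mk V b) (mk V (mode (-1) a b))]
  exact add_mem (IsFiltration.F_lt_le_F (weightLE V) _ _ (mk_mul_mk_sub_mk_mode_mem ha hb))
    (mk_mem_weightLE le_rfl (mode_mem ha hb (by push_cast; ring)))

instance : IsRingFiltration (weightLE V) (weightLT V) where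
  one_mem := mk_mem_weightLE le_rfl vac_mem
  mul_mem k l y z hy hz := by
    have hle : (⨆ p ≤ k, (gr (V := V) p).map (mk V)) * (⨆ q ≤ l, (gr (V := V) q).map (mk V)) ≤
        weightLE V (k + l) := by
      simp only [Submodule.iSup_mul, Submodule.mul_iSup]
      refine iSup₂_le fun q hq => iSup₂_le fun p hp => Submodule.mul_le.2 ?_
      rintro _ ⟨a, ha, rfl⟩ _ ⟨b, hb, rfl⟩
      exact IsFiltration.mono (F := weightLE V) (add_le_add hp hq) (mk_mul_mk_mem_weightLE ha hb)
    exact hle (Submodule.mul_mem_mul hy hz)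

variable {σ : Type*} {x : σ → V} {w : σ → ℕ}

theorem mk_mode_neg_succ_mem_sup_wordSpan (hw : ∀ i, x i ∈ gr (V := V) (w i)) {k : ℕ} {v : V}
    (hv : v ∈ gr (V := V) k)
    (hmk : mk V v ∈ weightLT V k ⊔ wordSpan ℂ (fun i => mk V (x i)) w k) (i : σ) (m : ℕ) :
    mk V (mode (-(m + 1 : ℕ)) (x i) v) ∈
      weightLT V (w i + k + m) ⊔ wordSpan ℂ (fun i => mk V (x i)) w (w i + k + m) := by
  cases m with
  | zero =>
    have hmul := mul_mem_sup_wordSpan (F := weightLE V)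
      (fun i => mk_mem_weightLE le_rfl (hw i)) i hmk
    have hsub := Submodule.mem_sup_left
      (T := wordSpan ℂ (fun i => mk V (x i)) w (w i + k)) (mk_mul_mk_sub_mk_mode_mem (hw i) hv)
    simpa using sub_mem hmul hsub
  | succ m =>
    have hexp : (-((m + 1 + 1 : ℕ) : ℤ)) = -2 - m := by push_cast; ring
    rw [hexp]
    exact Submodule.mem_sup_left (mk_mode_neg_two_sub_mem_weightLT (hw i) hv m)

theorem exists_foldr_mode_mem (hw : ∀ i, x i ∈ gr (V := V) (w i)) (l : List (V × ℕ))
    (hl : ∀ u ∈ l, u.1 ∈ Set.range x ∧ 1 ≤ u.2) :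
    ∃ k, l.foldr (fun u v => mode (-(u.2 : ℤ)) u.1 v) vac ∈ gr (V := V) k ⊓
      (weightLT V k ⊔ wordSpan ℂ (fun i => mk V (x i)) w k).comap (mk V) := by
  induction l with
  | nil =>
    exact ⟨0, vac_mem, Submodule.mem_sup_right
      (list_prod_mem_wordSpan (fun i => mk V (x i)) w [])⟩
  | cons u l ih =>
    obtain ⟨k, hv, hmk⟩ := ih fun u hu => hl u (List.mem_cons_of_mem _ hu)
    obtain ⟨a, n⟩ := u
    obtain ⟨⟨i, rfl⟩, hn⟩ := hl _ List.mem_cons_self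
    obtain ⟨m, rfl⟩ := Nat.exists_eq_add_of_le' hn
    exact ⟨w i + k + m, mode_mem (hw i) hv (by push_cast; ring),
      mk_mode_neg_succ_mem_sup_wordSpan hw hv hmk i m⟩

theorem gr_le_comap_sup_wordSpan (hw : ∀ i, x i ∈ gr (V := V) (w i))
    (hgen : StronglyGeneratedBy (Set.range x)) (k : ℕ) :
    gr (V := V) k ≤ (weightLT V k ⊔ wordSpan ℂ (fun i => mk V (x i)) w k).comap (mk V) := by
  -- The vectors spanning `V` are homogeneous, so they span each weight space separately.
  let s : ℕ → Submodule ℂ V := fun k =>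
    gr k ⊓ (weightLT V k ⊔ wordSpan ℂ (fun i => mk V (x i)) w k).comap (mk V)
  have hs : ⨆ k, s k = ⊤ := by
    rw [eq_top_iff, ← show _ = _ from hgen, Submodule.span_le]
    rintro _ ⟨l, hl, rfl⟩
    obtain ⟨k, hk⟩ := exists_foldr_mode_mem hw l hl
    exact Submodule.mem_iSup_of_mem k hk
  have heq : s = gr := iSupIndep_eq_of_le_of_iSup_eq_top isInternal.submodule_iSupIndep
    (fun _ => inf_le_left) hs
  exact inf_eq_left.1 (congrFun heq k)

theorem weightLE_le_sup_wordSpan (hw : ∀ i, x i ∈ gr (V := V) (w i))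
    (hgen : StronglyGeneratedBy (Set.range x)) (k : ℕ) :
    weightLE V k ≤ weightLT V k ⊔ wordSpan ℂ (fun i => mk V (x i)) w k := by
  refine iSup₂_le fun j hj => Submodule.map_le_iff_le_comap.2 ?_
  obtain hjk | rfl := hj.lt_or_eq
  · exact fun _ ha => Submodule.mem_sup_left (mk_mem_weightLT hjk ha)
  · exact gr_le_comap_sup_wordSpan hw hgen j

end ZhuAlgebra

end VertexOperatorAlgebra

theorem corollary3p4 {V : Type*} [AddCommGroup V] [Module ℂ V] [VertexOperatorAlgebra V]
    (n : ℕ) (x : Fin n → V) (hx : ∀ i, VertexOperatorAlgebra.IsHomogeneous (x i))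
    (hgen : VertexOperatorAlgebra.StronglyGeneratedBy (Set.range x)) :
    IsNoetherianRing (VertexOperatorAlgebra.ZhuAlgebra V) := by
  choose w hw using hx
  exact isNoetherianRing_of_almostCommutative (F := VertexOperatorAlgebra.ZhuAlgebra.weightLE V)
    (fun i => VertexOperatorAlgebra.ZhuAlgebra.mk_mem_weightLE le_rfl (hw i))
    (fun i j => VertexOperatorAlgebra.ZhuAlgebra.mk_mul_mk_sub_mul_mem (hw i) (hw j))
    (VertexOperatorAlgebra.ZhuAlgebra.weightLE_le_sup_wordSpan hw hgen)
    VertexOperatorAlgebra.ZhuAlgebra.exists_mem_weightLE
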